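/- Write a CSS code with check matrices $H_X\in\mathbb F_2^{m_X\times n}$, $H_Z\in\mathbb F_2^{m_Z\times n}$, $H_XH_Z^{\intercal}=0$, as the based chain complex $C_\bullet=(\mathbb F_2^{m_Z}\xrightarrow{H_Z^{\intercal}}\mathbb F_2^{n}\xrightarrow{H_X}\mathbb F_2^{m_X})$ in degrees $2,1,0$. Its distance is the minimum Hamming weight of the vectors in $\ker H_X\setminus\operatorname{im}H_Z^{\intercal}$ and in $\ker H_Z\setminus\operatorname{im}H_X^{\intercal}$ ($\infty$ if there are none). A stabiliser code $Q$ on $n$ qubits with generators $S_1,\dots,S_m$ has soundness $\rho$ if $$\frac1m\sum_{i=1}^m\tfrac12(I-S_i)\succeq\frac{\rho}{n}\sum_{t\ge1}t\,(\Pi_{Q_t}-\Pi_{Q_{t-1}}),$$ where $\Pi_{Q_t}$ is the orthogonal projection onto the span $Q_t$ of the states $(M_1\otimes\cdots\otimes M_n)\psi$ with $\psi\in Q$ and at most $t$ of the $M_i$ different from $I$. Let $A_\bullet$ be a CSS code with $n_A>0$ qubits, $m_X$ $X$-checks, $m_Z$ $Z$-checks and $m_A=m_X+m_Z>0$ checks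 in total, and suppose that it has quantum soundness $\rho_A>0$ (for some locality). Let $C^{(j)}_\bullet$, $j\in J$ ($J$ finite), be CSS codes and let $f^{(j)}_\bullet:A_\bullet\to C^{(j)}_\bullet$ be injective chain maps that send each qubit, $X$-check and $Z$-check of $A$ to a single qubit, $X$-check and $Z$-check of $C^{(j)}$. Let $\mathcal H$ be the hypergraph whose vertices are the qubits of $A$, whose hyperedges are the $X$-checks of $A$, and whose incidence matrix is $G=H_X(A)^{\intercal}$. For a natural number $L$ let $\mathcal H_L=\mathcal H\,\square\,\mathcal J_L$ be $\mathcal H$ thickened $L$ times, where $\mathcal J_L$ is the path with $L$ vertices and $L-1$ edges; thus $\mathcal H_L$ has $Ln_A$ vertices and $Lm_X+(L-1)n_A$ hyperedges. For any levels $\ell_j\in\{1,\dots,L\}$, and any cycle basis $N$ of $\mathcal H_L$ (an injective matrix whose image is the kernel of the incidence matrix of $\mathcal H_L$), let $D$ be the deformed code: the mapping cone of $\sum_jf^{(j)}_\bullet$, with $f^{(j)}$ attached at level $\ell_j$ of $\mathcal H_L$, so that the hyperedges of $\mathcal H_L$ are new qubits and its vertices are new $Z$-checks, together with one new $X$-check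 for each cycle in the basis $N$ (all cycles are gauge-fixed). (1) If $L\ge\frac{2n_A}{\rho_Am_A}$ and every $C^{(j)}$ has distance at least $d$, then $D$ has distance at least $d$. (2) For each $\sigma\in\mathbb N$ there is a constant $c>0$, depending only on $\sigma$, such that if all row and column weights of the check matrices of $A$ are at most $\sigma$, and $A$ has distance at least $2$ or each qubit of $A$ lies in the support of some check of $A$, then for $L=\lceil\frac{2n_A}{\rho_Am_A}\rceil$ the total number of new qubits, new $Z$-checks and new cycle checks is at most $c\,\frac{n_A}{\rho_A}$. -/

import Mathlib

open Matrix
open scoped Kronecker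

noncomputable section

/-! ### CSS codes, logical operators and distance -/

/-- A CSS code with qubits `Q`, `X`-checks `X` and `Z`-checks `Z`; equivalently the based chain
complex `𝔽₂^Z --HZᵀ--> 𝔽₂^Q --HX--> 𝔽₂^X` (in degrees 2, 1, 0). -/
structure CSSCode (Q X Z : Type*) [Fintype Q] where
  HX : Matrix X Q (ZMod 2)
  HZ : Matrix Z Q (ZMod 2)
  comm : HX * HZᵀ = 0

namespace CSSCode

variable {Q X Z : Type*} [Fintype Q] [Fintype X] [Fintype Z]

/-- The minimum weight of a nontrivial logical `Z` operator, `⊤` if there is none. -/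
def distZ (C : CSSCode Q X Z) : ℕ∞ :=
  ⨅ (v : Q → ZMod 2) (_ : C.HX *ᵥ v = 0) (_ : ¬ ∃ w : Z → ZMod 2, C.HZᵀ *ᵥ w = v),
    (hammingNorm v : ℕ∞)

/-- The minimum weight of a nontrivial logical `X` operator, `⊤` if there is none. -/
def distX (C : CSSCode Q X Z) : ℕ∞ :=
  ⨅ (u : Q → ZMod 2) (_ : C.HZ *ᵥ u = 0) (_ : ¬ ∃ w : X → ZMod 2, C.HXᵀ *ᵥ w = u),
    (hammingNorm u : ℕ∞)

/-- The code distance. -/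
def distance (C : CSSCode Q X Z) : ℕ∞ := min C.distX C.distZ

/-- All row and column weights of both check matrices are at most `σ`. -/
def IsSparse (C : CSSCode Q X Z) (σ : ℕ) : Prop :=
  (∀ i, hammingNorm (C.HX i) ≤ σ) ∧ (∀ q, hammingNorm (C.HXᵀ q) ≤ σ) ∧
  (∀ i, hammingNorm (C.HZ i) ≤ σ) ∧ (∀ q, hammingNorm (C.HZᵀ q) ≤ σ)

/-- Every qubit lies in the support of at least one check. -/
def EveryQubitChecked (C : CSSCode Q X Z) : Prop :=
  ∀ q, (∃ i, C.HX i q ≠ 0) ∨ (∃ i, C.HZ i q ≠ 0)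

end CSSCode

/-! ### Quantum soundness -/

/-- The Hilbert space of a set `Q` of qubits, with computational basis `𝔽₂^Q`. -/
abbrev QubitSpace (Q : Type*) [Fintype Q] : Type _ := EuclideanSpace ℂ (Q → ZMod 2)

section Operators

variable {Q : Type*} [Fintype Q] [DecidableEq Q]

/-- The product operator `⨂ q, M q`. -/
def tensorOp (M : Q → Matrix (ZMod 2) (ZMod 2) ℂ) : QubitSpace Q →L[ℂ] QubitSpace Q :=
  Matrix.toEuclideanCLM (n := Q → ZMod 2) (𝕜 := ℂ)
    (Matrix.of fun x y => ∏ q, M q (x q) (y q))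

/-- The one-qubit Pauli matrix `X`. -/
def pauliMatX : Matrix (ZMod 2) (ZMod 2) ℂ := Matrix.of fun x y => if x = y then 0 else 1

/-- The one-qubit Pauli matrix `Z`. -/
def pauliMatZ : Matrix (ZMod 2) (ZMod 2) ℂ :=
  Matrix.diagonal fun x => if x = 0 then 1 else -1

/-- The Pauli operator `X(u)`. -/
def pauliX (u : Q → ZMod 2) : QubitSpace Q →L[ℂ] QubitSpace Q :=
  tensorOp fun q => if u q = 0 then 1 else pauliMatX

/-- The Pauli operator `Z(v)`. -/
def pauliZ (v : Q → ZMod 2) : QubitSpace Q →L[ℂ] QubitSpace Q :=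
  tensorOp fun q => if v q = 0 then 1 else pauliMatZ

variable {K : Type*}

/-- The common `+1` eigenspace of a family of operators (the generators of a stabiliser group). -/
def codeSpace (S : K → (QubitSpace Q →L[ℂ] QubitSpace Q)) : Submodule ℂ (QubitSpace Q) :=
  ⨅ i, LinearMap.eqLocus (S i : QubitSpace Q →ₗ[ℂ] QubitSpace Q) LinearMap.id

open Classical in
/-- The `t`-fattening of a code space: the span of the states obtained from code states by product
operators that differ from the identity on at most `t` qubits. -/
def fattening (W : Submodule ℂ (QubitSpace Q)) (t : ℕ) : Submodule ℂ (QubitSpace Q) :=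
  Submodule.span ℂ {φ | ∃ M : Q → Matrix (ZMod 2) (ZMod 2) ℂ, ∃ ψ ∈ W,
    (Finset.univ.filter fun q => M q ≠ 1).card ≤ t ∧ φ = tensorOp M ψ}

/-- `∑_{t ≥ 1} t (Π_t - Π_{t-1})`, with `Π_t` the orthogonal projection onto the `t`-fattening. The
fattenings are constant from `t = |Q|` on, so that the later terms vanish. -/
def distOp (W : Submodule ℂ (QubitSpace Q)) : QubitSpace Q →L[ℂ] QubitSpace Q :=
  ∑ t ∈ Finset.Icc 1 (Fintype.card Q),
    (t : ℂ) • ((fattening W t).starProjection - (fattening W (t - 1)).starProjection)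

/-- The stabiliser code with generators `S i` has soundness `ρ`:
`(1/m) ∑ i, (1 - S i)/2 ⪰ (ρ/n) D` for the operator `D` above. -/
def HasQuantumSoundness [Fintype K] (S : K → (QubitSpace Q →L[ℂ] QubitSpace Q)) (ρ : ℝ) : Prop :=
  ((Fintype.card K : ℂ)⁻¹ • ∑ i, (1 / 2 : ℂ) • (1 - S i)
    - ((ρ / Fintype.card Q : ℝ) : ℂ) • distOp (codeSpace S)).IsPositive

end Operators

namespace CSSCode

variable {Q X Z : Type*} [Fintype Q] [DecidableEq Q] [Fintype X] [Fintype Z]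

/-- The stabiliser generators of a CSS code. -/
def generators (C : CSSCode Q X Z) : X ⊕ Z → (QubitSpace Q →L[ℂ] QubitSpace Q) :=
  Sum.elim (fun i => pauliX (C.HX i)) (fun i => pauliZ (C.HZ i))

/-- The CSS code is quantum locally testable with locality `ω` and soundness `ρ`. -/
def IsLocallyTestable (C : CSSCode Q X Z) (ω : ℕ) (ρ : ℝ) : Prop :=
  (∀ i, hammingNorm (C.HX i) ≤ ω) ∧ (∀ i, hammingNorm (C.HZ i) ≤ ω) ∧
    HasQuantumSoundness C.generators ρ

end CSSCode

/-! ### Subcodes -/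

/-- The matrix over `𝔽₂` of the linear map that sends each basis vector `a` to `f a`. -/
def basisMatrix {α β : Type*} [DecidableEq β] (f : α → β) : Matrix β α (ZMod 2) :=
  Matrix.of fun b a => if f a = b then 1 else 0

/-- An injective, basis-preserving chain map from `A` to `C`, which makes `A` a subcode of `C`. -/
structure SubcodeMap {QA XA ZA Q X Z : Type*} [Fintype QA] [Fintype XA]
    [Fintype Q] [Fintype Z] [DecidableEq Q] [DecidableEq X] [DecidableEq Z]
    (A : CSSCode QA XA ZA) (C : CSSCode Q X Z) where
  qubit : QA ↪ Q
  xCheck : XA ↪ X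
  zCheck : ZA ↪ Z
  comm_one : basisMatrix xCheck * A.HX = C.HX * basisMatrix qubit
  comm_two : basisMatrix qubit * A.HZᵀ = C.HZᵀ * basisMatrix zCheck

/-! ### Hypergraphs, thickening, cycle bases -/

/-- The hypergraph of a code, through its edge-vertex incidence matrix `𝔽₂^E → 𝔽₂^V`: the vertices
are the qubits, the hyperedges are the `X`-checks. -/
def CSSCode.incidence {Q X Z : Type*} [Fintype Q] (A : CSSCode Q X Z) : Matrix Q X (ZMod 2) :=
  A.HXᵀ

/-- The incidence matrix of the path graph with `L` vertices and `L - 1` edges. -/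
def pathIncidence (L : ℕ) : Matrix (Fin L) (Fin (L - 1)) (ZMod 2) :=
  Matrix.of fun l k => if (l : ℕ) = k ∨ (l : ℕ) = k + 1 then 1 else 0

/-- The incidence matrix of a hypergraph thickened `L` times, that is, of its Cartesian product with
the path graph on `L` vertices. -/
def thicken {V E : Type*} [DecidableEq V] (G : Matrix V E (ZMod 2)) (L : ℕ) :
    Matrix (V × Fin L) (E × Fin L ⊕ V × Fin (L - 1)) (ZMod 2) :=
  Matrix.fromCols (G ⊗ₖ (1 : Matrix (Fin L) (Fin L) (ZMod 2)))
    ((1 : Matrix V V (ZMod 2)) ⊗ₖ pathIncidence L)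

/-- `N : 𝔽₂^F → 𝔽₂^E` is a cycle basis of the hypergraph with incidence matrix `G`. -/
def IsCycleBasis {V E F : Type*} [Fintype E] [Fintype F] (G : Matrix V E (ZMod 2))
    (N : Matrix E F (ZMod 2)) : Prop :=
  Function.Injective N.mulVec ∧ LinearMap.range N.mulVecLin = LinearMap.ker G.mulVecLin

theorem IsCycleBasis.mul_eq_zero {V E F : Type*} [Fintype E] [Fintype F]
    {G : Matrix V E (ZMod 2)} {N : Matrix E F (ZMod 2)} (h : IsCycleBasis G N) : G * N = 0 := by
  classical
  ext i j
  have h1 : N.mulVecLin (Pi.single j 1) ∈ LinearMap.ker G.mulVecLin := by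
    rw [← h.2]; exact LinearMap.mem_range_self _ _
  have h2 := congrFun (LinearMap.mem_ker.1 h1) i
  simp only [Matrix.mulVecLin_apply, Matrix.mulVec_single_one] at h2
  exact h2

/-! ### Partial block reading with a thickened hypergraph -/

section Deformed

variable {QA XA ZA : Type*} [Fintype QA] [Fintype XA] [DecidableEq QA]
  {A : CSSCode QA XA ZA}
  {ι : Type*} [Fintype ι] [DecidableEq ι] {Q X Z : ι → Type*}
  [∀ j, Fintype (Q j)] [∀ j, Fintype (Z j)]
  [∀ j, DecidableEq (Q j)] [∀ j, DecidableEq (X j)] [∀ j, DecidableEq (Z j)]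
  {C : ∀ j, CSSCode (Q j) (X j) (Z j)} {L : ℕ}

/-- The component of the chain map `∑ j, f j` from the vertices of the thickened hypergraph to the
qubits of the blocks; block `j` is attached at level `lev j`. -/
def attachQubit (f : ∀ j, SubcodeMap A (C j)) (lev : ι → Fin L) :
    Matrix (Σ j, Q j) (QA × Fin L) (ZMod 2) :=
  Matrix.of fun p a => if a.2 = lev p.1 then basisMatrix (f p.1).qubit p.2 a.1 else 0

/-- The component of the chain map `∑ j, f j` from the hyperedges of the thickened hypergraph to
the `X`-checks of the blocks. -/
def attachXCheck (f : ∀ j, SubcodeMap A (C j)) (lev : ι → Fin L) :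
    Matrix (Σ j, X j) (XA × Fin L ⊕ QA × Fin (L - 1)) (ZMod 2) :=
  Matrix.fromCols
    (Matrix.of fun p b => if b.2 = lev p.1 then basisMatrix (f p.1).xCheck p.2 b.1 else 0) 0

theorem attach_comm (f : ∀ j, SubcodeMap A (C j)) (lev : ι → Fin L) :
    Matrix.blockDiagonal' (fun j => (C j).HX) * attachQubit f lev
      = attachXCheck f lev * (thicken A.incidence L)ᵀ := by
  ext ⟨j, x⟩ ⟨a, l⟩
  have key := congrFun (congrFun (f j).comm_one x) a
  simp only [Matrix.mul_apply] at key
  simp only [Matrix.mul_apply, attachQubit, attachXCheck, thicken, Matrix.transpose_apply,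
    Fintype.sum_sum_type, Matrix.fromCols_apply_inl, Matrix.fromCols_apply_inr, Matrix.zero_apply,
    zero_mul, Finset.sum_const_zero, add_zero, Matrix.of_apply, Fintype.sum_sigma,
    Fintype.sum_prod_type, Matrix.kroneckerMap_apply, CSSCode.incidence, Matrix.one_apply]
  rw [Finset.sum_eq_single j]
  · by_cases hl : l = lev j
    · subst hl
      simpa [Matrix.blockDiagonal'_apply_eq] using key.symm
    · simp [hl]
  · intro k _ hk
    simp [Matrix.blockDiagonal'_apply_ne _ _ _ (Ne.symm hk)]
  · simp

/-- The deformed code of the partial block reading of `Z` type given by the subcode maps `f j`, with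
the hypergraph of `A` thickened `L` times, block `j` attached at level `lev j`, and all cycles
gauge-fixed by the cycle basis `N`.

It is the mapping cone of the chain map `∑ j, f j` from the (degree-shifted) thickened hypergraph to
the sum of the blocks, together with the cycle checks: new qubits are the hyperedges, new `Z`-checks
the vertices, new `X`-checks the cycles in the basis. -/
def deformedCode (f : ∀ j, SubcodeMap A (C j)) (lev : ι → Fin L) {F : Type*} [Fintype F]
    (N : Matrix (XA × Fin L ⊕ QA × Fin (L - 1)) F (ZMod 2))
    (hN : IsCycleBasis (thicken A.incidence L) N) :
    CSSCode ((Σ j, Q j) ⊕ (XA × Fin L ⊕ QA × Fin (L - 1)))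
      ((Σ j, X j) ⊕ F) ((Σ j, Z j) ⊕ QA × Fin L) where
  HX := Matrix.fromBlocks (Matrix.blockDiagonal' fun j => (C j).HX) (attachXCheck f lev) 0 Nᵀ
  HZ := Matrix.fromBlocks (Matrix.blockDiagonal' fun j => (C j).HZ) 0
    (attachQubit f lev)ᵀ (thicken A.incidence L)
  comm := by
    have h1 : (Matrix.blockDiagonal' fun j => (C j).HX)
        * (Matrix.blockDiagonal' fun j => (C j).HZ)ᵀ = 0 := by
      rw [Matrix.blockDiagonal'_transpose, ← Matrix.blockDiagonal'_mul]
      simp only [(C _).comm]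
      exact Matrix.blockDiagonal'_zero
    have h2 : Nᵀ * (thicken A.incidence L)ᵀ = 0 := by
      rw [← Matrix.transpose_mul, hN.mul_eq_zero, Matrix.transpose_zero]
    rw [Matrix.fromBlocks_transpose, Matrix.fromBlocks_multiply, Matrix.transpose_transpose,
      attach_comm, h1, h2]
    have h3 : ∀ M : Matrix (Σ j, X j) (QA × Fin L) (ZMod 2), M + M = 0 := fun M => by
      ext i k; exact CharTwo.add_self_eq_zero _
    simp [h3]

end Deformed

end

/-!
Soundness is used only through the classical soundness of `HX` and `HZ`: a code state hit by a Pauli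
error of minimal weight among those with its syndrome is an eigenstate of every generator, violates
as many of them as the syndrome has ones, and is orthogonal to all smaller fattenings.

A nontrivial logical `X` operator of the deformed code stays nontrivial on some block, because every
cycle of the thickened hypergraph is a product of cycle checks. The hypergraph part of a logical `Z`
operator is a coboundary, as it commutes with all cycle checks, and multiplying by vertex checks
moves it into the blocks. By the pigeonhole principle over the `L` levels and the soundness of `HX`,
one level can be moved with weight at most that of the coboundary inside the levels; passing from
there to any other level costs at most the weight on the rungs. Hence cleaning does not increase the
weight.

For the space cost, all counts are `O(L m)`, where `L m` is about `2 n / ρ` up to an additive `m`,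
and `m = O(n / ρ)` since the syndrome of a single qubit has weight at most `σ`.
-/

/-! ### Linear functionals and the dot product -/

section LinearAlgebra

variable {m n K : Type*} [Fintype n] [Field K]

theorem exists_dotProduct_ne_zero_of_notMem {U : Submodule K (n → K)} {v : n → K} (hv : v ∉ U) :
    ∃ g : n → K, (∀ x ∈ U, g ⬝ᵥ x = 0) ∧ g ⬝ᵥ v ≠ 0 := by
  classical
  obtain ⟨φ, hφv, hφU⟩ := Submodule.exists_le_ker_of_notMem hv
  obtain ⟨g, rfl⟩ := (dotProductEquiv K n).surjective φ
  exact ⟨g, fun x hx => hφU hx, hφv⟩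

theorem exists_transpose_mulVec_eq [Fintype m] (M : Matrix m n K) (v : n → K)
    (hv : ∀ x, M *ᵥ x = 0 → v ⬝ᵥ x = 0) : ∃ w, Mᵀ *ᵥ w = v := by
  by_contra hnot
  obtain ⟨x, hx, hxv⟩ :=
    exists_dotProduct_ne_zero_of_notMem (U := LinearMap.range Mᵀ.mulVecLin) hnot
  refine hxv ((dotProduct_comm x v).trans (hv x (dotProduct_eq_zero _ fun w => ?_)))
  rw [dotProduct_comm, Matrix.dotProduct_mulVec, ← Matrix.mulVec_transpose, dotProduct_comm]
  exact hx _ ⟨w, rfl⟩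

theorem exists_vecMul_eq_zero_on_and_dotProduct_ne_zero [Fintype m] (M : Matrix m n K) (v : n → K)
    (T : Set n) (hT : ∀ v', M *ᵥ v' = M *ᵥ v → ∃ q ∉ T, v' q ≠ 0) :
    ∃ g : m → K, (∀ q ∈ T, (g ᵥ* M) q = 0) ∧ g ᵥ* M ⬝ᵥ v ≠ 0 := by
  classical
  have hv : M *ᵥ v ∉ (Submodule.pi Tᶜ fun _ => (⊥ : Submodule K K)).map M.mulVecLin := by
    rintro ⟨v', hv', hMv'⟩
    obtain ⟨q, hq, hne⟩ := hT v' hMv'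
    exact hne (hv' q hq)
  obtain ⟨g, hg, hgv⟩ := exists_dotProduct_ne_zero_of_notMem hv
  refine ⟨g, fun q hq => ?_, by rwa [← Matrix.dotProduct_mulVec]⟩
  rw [← dotProduct_single_one (g ᵥ* M) q, ← Matrix.dotProduct_mulVec]
  refine hg _ ⟨Pi.single q 1, fun p hp => Pi.single_eq_of_ne ?_ 1, rfl⟩
  rintro rfl
  exact hp hq

end LinearAlgebra

/-! ### Pauli operators -/

/-- The nontrivial additive character `a ↦ (-1)ᵃ` of `𝔽₂`. -/
noncomputable def signChar : AddChar (ZMod 2) ℂ := AddChar.zmodChar 2 (ζ := -1) (by norm_num)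

theorem zmod_two_eq_zero_or_one (a : ZMod 2) : a = 0 ∨ a = 1 :=
  (eq_or_ne a 0).imp_right (Fin.eq_one_of_ne_zero a)

theorem signChar_one : signChar 1 = -1 := by
  simp [signChar, AddChar.zmodChar_apply, ZMod.val_one'']

theorem signChar_of_ne_zero {a : ZMod 2} (ha : a ≠ 0) : signChar a = -1 := by
  rw [(zmod_two_eq_zero_or_one a).resolve_left ha, signChar_one]

theorem signChar_mul_self (a : ZMod 2) : signChar a * signChar a = 1 := by
  rw [← AddChar.map_add_eq_mul, CharTwo.add_self_eq_zero, AddChar.map_zero_eq_one]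

theorem conj_signChar (a : ZMod 2) : starRingEnd ℂ (signChar a) = signChar a := by
  rcases zmod_two_eq_zero_or_one a with rfl | rfl <;> simp [signChar_one]

theorem signChar_dotProduct {Q : Type*} [Fintype Q] (u v : Q → ZMod 2) :
    signChar (u ⬝ᵥ v) = ∏ q, signChar (u q * v q) :=
  map_prod signChar.toMonoidHom (fun q => Multiplicative.ofAdd (u q * v q)) Finset.univ

section Pauli

variable {Q : Type*} [Fintype Q] [DecidableEq Q]

theorem tensorOp_apply (M : Q → Matrix (ZMod 2) (ZMod 2) ℂ) (φ : QubitSpace Q) (x : Q → ZMod 2) :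
    tensorOp M φ x = ∑ y, (∏ q, M q (x q) (y q)) * φ y := by
  rw [tensorOp, Matrix.ofLp_toEuclideanCLM]
  rfl

theorem tensorOp_apply_of_row_eq_ite {M : Q → Matrix (ZMod 2) (ZMod 2) ℂ} {x y : Q → ZMod 2}
    {c : Q → ℂ} (hM : ∀ q b, M q (x q) b = if b = y q then c q else 0) (φ : QubitSpace Q) :
    tensorOp M φ x = (∏ q, c q) * φ y := by
  simp only [tensorOp_apply, hM, Finset.prod_ite_zero, Finset.mem_univ, forall_const,
    ← funext_iff, ite_mul, zero_mul, Finset.sum_ite_eq', if_true]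

theorem tensorOp_mul (M M' : Q → Matrix (ZMod 2) (ZMod 2) ℂ) :
    tensorOp M * tensorOp M' = tensorOp fun q => M q * M' q := by
  rw [tensorOp, tensorOp, ← map_mul, tensorOp]
  congr 1
  ext x y
  simp only [Matrix.mul_apply, Matrix.of_apply, ← Finset.prod_mul_distrib]
  rw [Finset.prod_univ_sum, Fintype.piFinset_univ]

theorem tensorOp_commute {M M' : Q → Matrix (ZMod 2) (ZMod 2) ℂ} (h : ∀ q, Commute (M q) (M' q)) :
    Commute (tensorOp M) (tensorOp M') := by
  simp only [commute_iff_eq, tensorOp_mul, (h _).eq]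

theorem pauliX_apply (u : Q → ZMod 2) (φ : QubitSpace Q) (x : Q → ZMod 2) :
    pauliX u φ x = φ (x + u) := by
  have hrow (a b c : ZMod 2) :
      (if a = 0 then (1 : Matrix (ZMod 2) (ZMod 2) ℂ) else pauliMatX) b c
        = if c = b + a then 1 else 0 := by
    rcases zmod_two_eq_zero_or_one a with rfl | rfl <;>
      rcases zmod_two_eq_zero_or_one b with rfl | rfl <;>
      rcases zmod_two_eq_zero_or_one c with rfl | rfl <;> simp [pauliMatX, CharTwo.add_self_eq_zero]
  rw [pauliX, tensorOp_apply_of_row_eq_ite fun q => hrow (u q) (x q), Finset.prod_const_one,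
    one_mul]
  rfl

theorem pauliZ_apply (v : Q → ZMod 2) (φ : QubitSpace Q) (x : Q → ZMod 2) :
    pauliZ v φ x = signChar (v ⬝ᵥ x) * φ x := by
  have hrow (a b c : ZMod 2) :
      (if a = 0 then (1 : Matrix (ZMod 2) (ZMod 2) ℂ) else pauliMatZ) b c
        = if c = b then signChar (a * b) else 0 := by
    rcases zmod_two_eq_zero_or_one a with rfl | rfl <;>
      rcases zmod_two_eq_zero_or_one b with rfl | rfl <;>
      rcases zmod_two_eq_zero_or_one c with rfl | rfl <;> simp [pauliMatZ, signChar_one]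
  rw [pauliZ, tensorOp_apply_of_row_eq_ite fun q => hrow (v q) (x q), signChar_dotProduct]

theorem pauliX_zero : pauliX (0 : Q → ZMod 2) = 1 := by
  ext φ x
  simp [pauliX_apply]

theorem pauliZ_zero : pauliZ (0 : Q → ZMod 2) = 1 := by
  ext φ x
  simp [pauliZ_apply]

theorem pauliX_add (u v : Q → ZMod 2) : pauliX (u + v) = pauliX u * pauliX v := by
  ext φ x
  simp [pauliX_apply, add_assoc]

theorem pauliZ_add (u v : Q → ZMod 2) : pauliZ (u + v) = pauliZ u * pauliZ v := by
  ext φ x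
  simp [pauliZ_apply, AddChar.map_add_eq_mul, mul_assoc]

theorem pauliX_pauliZ_apply (u v : Q → ZMod 2) (φ : QubitSpace Q) :
    pauliX u (pauliZ v φ) = signChar (u ⬝ᵥ v) • pauliZ v (pauliX u φ) := by
  ext x
  simp only [pauliX_apply, pauliZ_apply, PiLp.smul_apply, smul_eq_mul, dotProduct_add,
    AddChar.map_add_eq_mul, dotProduct_comm u v]
  ring

theorem pauliZ_pauliX_apply (u v : Q → ZMod 2) (φ : QubitSpace Q) :
    pauliZ u (pauliX v φ) = signChar (u ⬝ᵥ v) • pauliX v (pauliZ u φ) := by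
  rw [pauliX_pauliZ_apply, smul_smul, dotProduct_comm, signChar_mul_self, one_smul]

theorem inner_pauliX (u : Q → ZMod 2) (φ ψ : QubitSpace Q) :
    inner ℂ (pauliX u φ) (pauliX u ψ) = inner ℂ φ ψ := by
  simp only [PiLp.inner_apply, pauliX_apply]
  exact Equiv.sum_comp (Equiv.addRight u) fun x => inner ℂ (φ x) (ψ x)

theorem inner_pauliZ (v : Q → ZMod 2) (φ ψ : QubitSpace Q) :
    inner ℂ (pauliZ v φ) (pauliZ v ψ) = inner ℂ φ ψ := by
  simp only [PiLp.inner_apply, pauliZ_apply, ← smul_eq_mul, inner_smul_left, inner_smul_right,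
    conj_signChar]
  simp only [smul_eq_mul, ← mul_assoc, signChar_mul_self, one_mul]

theorem commute_pauliX (u v : Q → ZMod 2) : Commute (pauliX u) (pauliX v) := by
  rw [commute_iff_eq, ← pauliX_add, add_comm, pauliX_add]

theorem commute_pauliZ (u v : Q → ZMod 2) : Commute (pauliZ u) (pauliZ v) := by
  rw [commute_iff_eq, ← pauliZ_add, add_comm, pauliZ_add]

/-- The families `u ↦ X(u)` and `v ↦ Z(v)` of Pauli operators, in either order: `P` detects the
errors `E`, since `P u` and `E v` commute up to the sign `(-1)^(u ⬝ᵥ v)`. The two instances give the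
soundness of `HX` and that of `HZ` by the same argument. -/
structure IsPauliPair (P E : (Q → ZMod 2) → (QubitSpace Q →L[ℂ] QubitSpace Q)) : Prop where
  map_zero : P 0 = 1
  map_add : ∀ u v, P (u + v) = P u * P v
  inner_left : ∀ u φ ψ, inner ℂ (P u φ) (P u ψ) = inner ℂ φ ψ
  inner_right : ∀ v φ ψ, inner ℂ (E v φ) (E v ψ) = inner ℂ φ ψ
  apply_apply : ∀ u v φ, P u (E v φ) = signChar (u ⬝ᵥ v) • E v (P u φ)
  commute_tensorOp : ∀ u M, (∀ q, u q = 0 ∨ M q = 1) → Commute (P u) (tensorOp M)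
  exists_eq_tensorOp : ∀ v, ∃ M, E v = tensorOp M

theorem commute_tensorOp_ite (B : Matrix (ZMod 2) (ZMod 2) ℂ) {u : Q → ZMod 2}
    {M : Q → Matrix (ZMod 2) (ZMod 2) ℂ} (h : ∀ q, u q = 0 ∨ M q = 1) :
    Commute (tensorOp fun q => if u q = 0 then 1 else B) (tensorOp M) :=
  tensorOp_commute fun q => by
    rcases h q with h | h <;> simp [h]

theorem isPauliPair_pauliX_pauliZ : IsPauliPair (Q := Q) pauliX pauliZ where
  map_zero := pauliX_zero
  map_add := pauliX_add
  inner_left := inner_pauliX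
  inner_right := inner_pauliZ
  apply_apply := pauliX_pauliZ_apply
  commute_tensorOp _ _ := commute_tensorOp_ite _
  exists_eq_tensorOp _ := ⟨_, rfl⟩

theorem isPauliPair_pauliZ_pauliX : IsPauliPair (Q := Q) pauliZ pauliX where
  map_zero := pauliZ_zero
  map_add := pauliZ_add
  inner_left := inner_pauliZ
  inner_right := inner_pauliX
  apply_apply := pauliZ_pauliX_apply
  commute_tensorOp _ _ := commute_tensorOp_ite _
  exists_eq_tensorOp _ := ⟨_, rfl⟩

/-! ### From quantum soundness to classical soundness -/

variable {K : Type*}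

theorem mem_codeSpace {Q K : Type*} [Fintype Q] {S : K → (QubitSpace Q →L[ℂ] QubitSpace Q)}
    {ψ : QubitSpace Q} : ψ ∈ codeSpace S ↔ ∀ i, S i ψ = ψ := by
  simp [codeSpace, LinearMap.mem_eqLocus]

theorem fattening_mono (W : Submodule ℂ (QubitSpace Q)) : Monotone (fattening W) := by
  intro s t hst
  refine Submodule.span_mono ?_
  rintro φ ⟨M, ψ, hψ, hM, rfl⟩
  exact ⟨M, ψ, hψ, hM.trans hst, rfl⟩

theorem tensorOp_mem_fattening {W : Submodule ℂ (QubitSpace Q)}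
    (M : Q → Matrix (ZMod 2) (ZMod 2) ℂ) {ψ : QubitSpace Q} (hψ : ψ ∈ W) :
    tensorOp M ψ ∈ fattening W (Fintype.card Q) :=
  Submodule.subset_span ⟨M, ψ, hψ, Finset.card_le_univ _, rfl⟩

theorem mul_le_sum_mul_sub {a : ℕ → ℝ} (ha : Monotone a) {δ : ℕ} (hδ : ∀ t < δ, a t = 0) (N : ℕ) :
    δ * a N ≤ ∑ t ∈ Finset.Icc 1 N, (t : ℝ) * (a t - a (t - 1)) := by
  have htelescope : ∑ t ∈ Finset.range N, (a (t + 1) - a t) = a N - a 0 := Finset.sum_range_sub a N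
  have hterm (t : ℕ) : δ * (a (t + 1) - a t) ≤ ((t + 1 : ℕ) : ℝ) * (a (t + 1) - a t) := by
    rcases lt_or_ge (t + 1) δ with ht | ht
    · rw [hδ (t + 1) ht, hδ t (by omega), sub_zero, mul_zero, mul_zero]
    · exact mul_le_mul_of_nonneg_right (by exact_mod_cast ht) (sub_nonneg.2 (ha t.le_succ))
  have hzero : (δ : ℝ) * a 0 ≤ 0 := by
    rcases Nat.eq_zero_or_pos δ with rfl | h
    · simp
    · simp [hδ 0 h]
  calc δ * a N ≤ δ * (a N - a 0) := by linarith
    _ = ∑ t ∈ Finset.range N, δ * (a (t + 1) - a t) := by rw [← Finset.mul_sum, htelescope]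
    _ ≤ ∑ t ∈ Finset.range N, ((t + 1 : ℕ) : ℝ) * (a (t + 1) - a t) :=
      Finset.sum_le_sum fun t _ => hterm t
    _ = ∑ t ∈ Finset.Icc 1 N, (t : ℝ) * (a t - a (t - 1)) := by
      rw [Finset.range_eq_Ico, ← Finset.Ico_add_one_right_eq_Icc]
      exact Finset.sum_Ico_add' (fun t : ℕ => (t : ℝ) * (a t - a (t - 1))) 0 N 1

theorem re_inner_distOp (W : Submodule ℂ (QubitSpace Q)) (φ : QubitSpace Q) :
    (inner ℂ φ (distOp W φ)).re = ∑ t ∈ Finset.Icc 1 (Fintype.card Q),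
      (t : ℝ) * (‖(fattening W t).starProjection φ‖ ^ 2
        - ‖(fattening W (t - 1)).starProjection φ‖ ^ 2) := by
  have hproj (t : ℕ) : (inner ℂ φ ((fattening W t).starProjection φ)).re
      = ‖(fattening W t).starProjection φ‖ ^ 2 := by
    rw [← Submodule.inner_starProjection_left_eq_right]
    exact (fattening W t).re_inner_starProjection_eq_normSq φ
  simp only [distOp, _root_.sum_apply, inner_sum, Complex.re_sum, _root_.smul_apply,
    _root_.sub_apply, inner_smul_right, inner_sub_right]
  refine Finset.sum_congr rfl fun t _ => ?_
  rw [← Complex.ofReal_natCast, Complex.re_ofReal_mul, Complex.sub_re, hproj, hproj]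

theorem norm_starProjection_fattening_mono (W : Submodule ℂ (QubitSpace Q)) (φ : QubitSpace Q) :
    Monotone fun t => ‖(fattening W t).starProjection φ‖ := by
  intro s t hst
  have hcomp : (fattening W s).starProjection ((fattening W t).starProjection φ)
      = (fattening W s).starProjection φ :=
    DFunLike.congr_fun (Submodule.starProjection_comp_starProjection_of_le (fattening_mono W hst)) φ
  calc ‖(fattening W s).starProjection φ‖
      = ‖(fattening W s).starProjection ((fattening W t).starProjection φ)‖ := by rw [hcomp]
    _ ≤ ‖(fattening W t).starProjection φ‖ := (fattening W s).norm_starProjection_apply_le _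

theorem mul_norm_sq_le_re_inner_distOp {W : Submodule ℂ (QubitSpace Q)} {φ : QubitSpace Q}
    (hφ : φ ∈ fattening W (Fintype.card Q)) {δ : ℕ} (horth : ∀ t < δ, φ ∈ (fattening W t)ᗮ) :
    δ * ‖φ‖ ^ 2 ≤ (inner ℂ φ (distOp W φ)).re := by
  have hlast : (fattening W (Fintype.card Q)).starProjection φ = φ :=
    Submodule.starProjection_eq_self_iff.2 hφ
  have hmono : Monotone fun t => ‖(fattening W t).starProjection φ‖ ^ 2 := fun s t hst =>
    pow_le_pow_left₀ (norm_nonneg _) (norm_starProjection_fattening_mono W φ hst) 2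
  have h := mul_le_sum_mul_sub hmono (δ := δ) (fun t ht => by
    simp [(Submodule.starProjection_apply_eq_zero_iff _).2 (horth t ht)]) (Fintype.card Q)
  rwa [hlast, ← re_inner_distOp] at h

theorem sum_half_smul_one_sub_apply {V K : Type*} [SeminormedAddCommGroup V] [NormedSpace ℂ V]
    [Fintype K] [DecidableEq K] {S : K → (V →L[ℂ] V)} {φ : V} {s : Finset K}
    (hs : ∀ i, S i φ = if i ∈ s then -φ else φ) :
    (∑ i, (1 / 2 : ℂ) • (1 - S i)) φ = (s.card : ℂ) • φ := by
  have hterm (i : K) : ((1 / 2 : ℂ) • (1 - S i)) φ = if i ∈ s then φ else 0 := by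
    rw [_root_.smul_apply, _root_.sub_apply, one_apply_eq_self, hs]
    split_ifs
    · rw [sub_neg_eq_add, ← two_smul ℂ φ, smul_smul]
      norm_num
    · rw [sub_self, smul_zero]
  rw [_root_.sum_apply, Finset.sum_congr rfl fun i _ => hterm i, Finset.sum_ite_mem,
    Finset.univ_inter, Finset.sum_const, Nat.cast_smul_eq_nsmul]

theorem HasQuantumSoundness.mul_le_card_violated [Fintype K] [DecidableEq K]
    {S : K → (QubitSpace Q →L[ℂ] QubitSpace Q)} {ρ : ℝ} (hS : HasQuantumSoundness S ρ)
    (hρ : 0 ≤ ρ) {φ : QubitSpace Q} (hne : φ ≠ 0)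
    (hφ : φ ∈ fattening (codeSpace S) (Fintype.card Q)) {s : Finset K}
    (hs : ∀ i, S i φ = if i ∈ s then -φ else φ) {δ : ℕ}
    (horth : ∀ t < δ, φ ∈ (fattening (codeSpace S) t)ᗮ) :
    ρ * Fintype.card K / Fintype.card Q * δ ≤ s.card := by
  rcases (Fintype.card K).eq_zero_or_pos with hK | hK
  · simp [hK]
  have henergy : ρ / Fintype.card Q * (inner ℂ φ (distOp (codeSpace S) φ)).re
      ≤ (Fintype.card K : ℝ)⁻¹ * (s.card * ‖φ‖ ^ 2) := by
    have h := hS.re_inner_nonneg_right φ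
    rw [_root_.sub_apply, _root_.smul_apply, _root_.smul_apply, sum_half_smul_one_sub_apply hs,
      inner_sub_right, inner_smul_right, inner_smul_right, inner_smul_right,
      inner_self_eq_norm_sq_to_K, map_sub, sub_nonneg, RCLike.re_to_complex, RCLike.re_to_complex,
      Complex.re_ofReal_mul] at h
    refine h.trans_eq ?_
    rw [← Complex.ofReal_re ((Fintype.card K : ℝ)⁻¹ * _)]
    push_cast
    rfl
  have hdist := mul_norm_sq_le_re_inner_distOp hφ horth
  have hcoef : 0 ≤ ρ / Fintype.card Q := by positivity
  have hnorm : 0 < ‖φ‖ ^ 2 := by positivity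
  refine le_of_mul_le_mul_right ?_ hnorm
  calc ρ * Fintype.card K / Fintype.card Q * δ * ‖φ‖ ^ 2
      = Fintype.card K * (ρ / Fintype.card Q * (δ * ‖φ‖ ^ 2)) := by ring
    _ ≤ Fintype.card K * ((Fintype.card K : ℝ)⁻¹ * (s.card * ‖φ‖ ^ 2)) :=
      mul_le_mul_of_nonneg_left ((mul_le_mul_of_nonneg_left hdist hcoef).trans henergy)
        (Nat.cast_nonneg _)
    _ = s.card * ‖φ‖ ^ 2 := by field_simp

/-- A matrix `H` has classical soundness `κ` if every syndrome `s = H w` is the syndrome of an error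
of weight at most `|s| / κ`. The inequality is stated without division. -/
def IsClassicallySound {I V R : Type*} [Fintype I] [Fintype V] [Semiring R] [DecidableEq R]
    (H : Matrix I V R) (κ : ℝ) : Prop :=
  ∀ w, ∃ w', H *ᵥ w' = H *ᵥ w ∧ κ * hammingNorm w' ≤ hammingNorm (H *ᵥ w)

namespace IsPauliPair

variable {P E : (Q → ZMod 2) → (QubitSpace Q →L[ℂ] QubitSpace Q)} {I : Type*} [Fintype I]
  {H : Matrix I Q (ZMod 2)}

theorem apply_vecMul (hPE : IsPauliPair P E) {ψ : QubitSpace Q} (hψ : ∀ i, P (H i) ψ = ψ)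
    (g : I → ZMod 2) : P (g ᵥ* H) ψ = ψ := by
  rw [Matrix.vecMul_eq_sum]
  refine Finset.sum_induction _ (fun u => P u ψ = ψ) (fun u v hu hv => ?_) ?_ fun i _ => ?_
  · rw [hPE.map_add, mul_apply_eq_comp, hv, hu]
  · rw [hPE.map_zero, one_apply_eq_self]
  · rcases zmod_two_eq_zero_or_one (g i) with h | h
    · rw [h, zero_smul, hPE.map_zero, one_apply_eq_self]
    · rw [h, one_smul, hψ i]

-- If an error with support in `{q | M q ≠ 1}` cannot have the syndrome of `w`, then some stabiliser
-- commutes with `tensorOp M` and anticommutes with `E w`; it acts as `1` on `tensorOp M ψ'` and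
-- as `-1` on `E w ψ`.
theorem mem_fattening_orthogonal {I : Type*} [Finite I] {H : Matrix I Q (ZMod 2)}
    (hPE : IsPauliPair P E) {W : Submodule ℂ (QubitSpace Q)}
    (hW : ∀ ψ ∈ W, ∀ i, P (H i) ψ = ψ) {w : Q → ZMod 2} {t : ℕ}
    (hw : ∀ w', H *ᵥ w' = H *ᵥ w → t < hammingNorm w') {ψ : QubitSpace Q} (hψ : ψ ∈ W) :
    E w ψ ∈ (fattening W t)ᗮ := by
  classical
  have := Fintype.ofFinite I
  suffices fattening W t ≤ (ℂ ∙ E w ψ)ᗮ from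
    (Submodule.mem_orthogonal _ _).2 fun x hx =>
      Submodule.mem_orthogonal_singleton_iff_inner_left.1 (this hx)
  refine Submodule.span_le.2 ?_
  rintro _ ⟨M, ψ', hψ', hM, rfl⟩
  refine Submodule.mem_orthogonal_singleton_iff_inner_left.2 ?_
  have hsupport : ∀ w', H *ᵥ w' = H *ᵥ w → ∃ q ∉ {q | M q ≠ 1}, w' q ≠ 0 := by
    intro w' hw'
    by_contra! hzero
    refine (hw w' hw').not_ge (le_trans (Finset.card_le_card fun q hq => ?_) hM)
    simp only [Finset.mem_filter, Finset.mem_univ, true_and] at hq ⊢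
    exact fun hMq => hq (hzero q fun h => h hMq)
  obtain ⟨g, hgM, hgw⟩ := exists_vecMul_eq_zero_on_and_dotProduct_ne_zero H w _ hsupport
  have hfix : P (g ᵥ* H) (tensorOp M ψ') = tensorOp M ψ' := by
    have hcomm := hPE.commute_tensorOp (g ᵥ* H) M fun q => or_iff_not_imp_right.2 (hgM q)
    rw [← mul_apply_eq_comp, hcomm.eq, mul_apply_eq_comp, hPE.apply_vecMul (hW ψ' hψ')]
  have hflip : P (g ᵥ* H) (E w ψ) = -E w ψ := by
    rw [hPE.apply_apply, signChar_of_ne_zero hgw, hPE.apply_vecMul (hW ψ hψ), neg_one_smul]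
  have h := hPE.inner_left (g ᵥ* H) (tensorOp M ψ') (E w ψ)
  rw [hfix, hflip, inner_neg_right] at h
  exact self_eq_neg.1 h.symm

theorem apply_error_eq_ite [DecidableEq K] {S : K → (QubitSpace Q →L[ℂ] QubitSpace Q)}
    (hPE : IsPauliPair P E) (e : I ↪ K) (hSe : ∀ i, S (e i) = P (H i))
    (hSE : ∀ k ∉ Set.range e, ∀ w, Commute (S k) (E w)) {ψ : QubitSpace Q} (hψ : ψ ∈ codeSpace S)
    (w : Q → ZMod 2) (k : K) :
    S k (E w ψ) = if k ∈ (Finset.univ.filter fun i => (H *ᵥ w) i ≠ 0).map e then -E w ψ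
      else E w ψ := by
  by_cases hk : k ∈ Set.range e
  · obtain ⟨i, rfl⟩ := hk
    have hsyndrome : S (e i) (E w ψ) = signChar ((H *ᵥ w) i) • E w ψ := by
      rw [hSe, hPE.apply_apply, ← hSe, mem_codeSpace.1 hψ]
      rfl
    simp only [hsyndrome, Finset.mem_map', Finset.mem_filter, Finset.mem_univ, true_and]
    split_ifs with hi
    · rw [signChar_of_ne_zero hi, neg_one_smul]
    · rw [not_not.1 hi, AddChar.map_zero_eq_one, one_smul]
  · have hk' : k ∉ (Finset.univ.filter fun i => (H *ᵥ w) i ≠ 0).map e := fun h =>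
      hk (Set.mem_range.2 ((Finset.mem_map.1 h).imp fun _ => And.right))
    rw [if_neg hk', ← mul_apply_eq_comp, (hSE k hk w).eq, mul_apply_eq_comp, mem_codeSpace.1 hψ]

theorem isClassicallySound (hPE : IsPauliPair P E) [Fintype K]
    {S : K → (QubitSpace Q →L[ℂ] QubitSpace Q)} {ρ : ℝ} (hS : HasQuantumSoundness S ρ)
    (hρ : 0 ≤ ρ) (hne : ∃ ψ ∈ codeSpace S, ψ ≠ 0) (e : I ↪ K) (hSe : ∀ i, S (e i) = P (H i))
    (hSE : ∀ k ∉ Set.range e, ∀ w, Commute (S k) (E w)) :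
    IsClassicallySound H (ρ * Fintype.card K / Fintype.card Q) := by
  classical
  intro w
  obtain ⟨w', hw', hmin⟩ := Set.exists_min_image {w' | H *ᵥ w' = H *ᵥ w} hammingNorm
    (Set.toFinite _) ⟨w, rfl⟩
  refine ⟨w', hw', ?_⟩
  obtain ⟨ψ, hψ, hψ0⟩ := hne
  have hE0 : E w' ψ ≠ 0 := fun h0 => hψ0 <| inner_self_eq_zero.1 <| by
    rw [← hPE.inner_right w', h0, inner_zero_left]
  have hEmem : E w' ψ ∈ fattening (codeSpace S) (Fintype.card Q) := by
    obtain ⟨M, hM⟩ := hPE.exists_eq_tensorOp w'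
    exact hM ▸ tensorOp_mem_fattening M hψ
  have horth : ∀ t < hammingNorm w', E w' ψ ∈ (fattening (codeSpace S) t)ᗮ := fun t ht =>
    hPE.mem_fattening_orthogonal (fun ψ hψ i => by rw [← hSe, mem_codeSpace.1 hψ])
      (fun v hv => ht.trans_le (hmin v (hv.trans hw'))) hψ
  have h := hS.mul_le_card_violated hρ hE0 hEmem (hPE.apply_error_eq_ite e hSe hSE hψ w') horth
  rw [Finset.card_map, hw'] at h
  exact h

end IsPauliPair

end Pauli

namespace CSSCode

theorem HZ_mul_HX_transpose {Q X Z : Type*} [Fintype Q] (C : CSSCode Q X Z) :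
    C.HZ * C.HXᵀ = 0 := by
  rw [← Matrix.transpose_transpose C.HZ, ← Matrix.transpose_mul, C.comm, Matrix.transpose_zero]

variable {Q X Z : Type*} [Fintype Q] [DecidableEq Q]

-- The state is the unnormalised uniform superposition of the vectors in the row space of `HX`.
theorem exists_mem_codeSpace_ne_zero [Finite X] (C : CSSCode Q X Z) :
    ∃ ψ ∈ codeSpace C.generators, ψ ≠ 0 := by
  classical
  have := Fintype.ofFinite X
  let R := LinearMap.range C.HXᵀ.mulVecLin
  let ψ : QubitSpace Q := WithLp.toLp 2 fun x => if x ∈ R then 1 else 0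
  have hψ (x : Q → ZMod 2) : ψ x = if x ∈ R then 1 else 0 := rfl
  have hψ0 : ψ ≠ 0 := fun h => by simpa [h] using hψ 0
  refine ⟨ψ, mem_codeSpace.2 ?_, hψ0⟩
  rintro (i | i) <;> ext x
  · have hi : C.HX i ∈ R := ⟨Pi.single i 1, by ext q; simp⟩
    simp [generators, pauliX_apply, hψ, R.add_mem_iff_left hi]
  · simp only [generators, Sum.elim_inr, pauliZ_apply, hψ]
    split_ifs with hx
    · obtain ⟨g, rfl⟩ := hx
      have hdot : C.HZ i ⬝ᵥ C.HXᵀ *ᵥ g = 0 := by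
        change (C.HZ *ᵥ (C.HXᵀ *ᵥ g)) i = 0
        rw [Matrix.mulVec_mulVec, C.HZ_mul_HX_transpose, Matrix.zero_mulVec, Pi.zero_apply]
      rw [Matrix.mulVecLin_apply, hdot, AddChar.map_zero_eq_one, one_mul]
    · rw [mul_zero]

variable [Fintype X] [Fintype Z] {C : CSSCode Q X Z} {ρ : ℝ}

theorem isClassicallySound_HX (hC : HasQuantumSoundness C.generators ρ) (hρ : 0 ≤ ρ) :
    IsClassicallySound C.HX
      (ρ * (Fintype.card X + Fintype.card Z : ℕ) / Fintype.card Q) := by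
  rw [← Fintype.card_sum]
  refine isPauliPair_pauliX_pauliZ.isClassicallySound hC hρ C.exists_mem_codeSpace_ne_zero
    Function.Embedding.inl (fun _ => rfl) ?_
  rintro (i | i) hi w
  · exact absurd ⟨i, rfl⟩ hi
  · exact commute_pauliZ (C.HZ i) w

theorem isClassicallySound_HZ (hC : HasQuantumSoundness C.generators ρ) (hρ : 0 ≤ ρ) :
    IsClassicallySound C.HZ
      (ρ * (Fintype.card X + Fintype.card Z : ℕ) / Fintype.card Q) := by
  rw [← Fintype.card_sum]
  refine isPauliPair_pauliZ_pauliX.isClassicallySound hC hρ C.exists_mem_codeSpace_ne_zero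
    Function.Embedding.inr (fun _ => rfl) ?_
  rintro (i | i) hi w
  · exact commute_pauliX (C.HX i) w
  · exact absurd ⟨i, rfl⟩ hi

end CSSCode

/-! ### Hamming weights -/

section HammingNorm

variable {α β R : Type*} [Fintype α] [Fintype β] [DecidableEq R]

theorem hammingNorm_eq_sum_ite [Zero R] (v : α → R) :
    hammingNorm v = ∑ a, if v a ≠ 0 then 1 else 0 :=
  Finset.card_filter _ _

theorem hammingNorm_sumType [Zero R] (v : α ⊕ β → R) :
    hammingNorm v = hammingNorm (v ∘ Sum.inl) + hammingNorm (v ∘ Sum.inr) := by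
  simp only [hammingNorm_eq_sum_ite, Fintype.sum_sum_type, Function.comp_apply]

theorem hammingNorm_prodType [Zero R] (v : α × β → R) :
    hammingNorm v = ∑ b, hammingNorm fun a => v (a, b) := by
  simp only [hammingNorm_eq_sum_ite, Fintype.sum_prod_type_right]

theorem hammingNorm_comp_le_of_injective [Zero R] {f : α → β} (hf : f.Injective) (v : β → R) :
    hammingNorm (v ∘ f) ≤ hammingNorm v :=
  Finset.card_le_card_of_injOn f (by simp [Set.MapsTo]) hf.injOn

theorem hammingNorm_add_le [AddGroup R] (v w : α → R) :
    hammingNorm (v + w) ≤ hammingNorm v + hammingNorm w := by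
  calc hammingNorm (v + w) = hammingDist (-v) w := by
        rw [hammingDist_eq_hammingNorm, neg_neg]
    _ ≤ hammingDist (-v) 0 + hammingDist 0 w := hammingDist_triangle _ _ _
    _ = hammingNorm v + hammingNorm w := by
      rw [hammingDist_eq_hammingNorm, neg_neg, add_zero, hammingDist_zero_left]

theorem hammingNorm_basisMatrix_mulVec_le [DecidableEq β] (f : α → β) (w : α → ZMod 2) :
    hammingNorm (basisMatrix f *ᵥ w) ≤ hammingNorm w := by
  refine Finset.card_le_card_of_surjOn f fun b hb => ?_
  obtain ⟨a, -, ha⟩ := Finset.exists_ne_zero_of_sum_ne_zero (Finset.mem_filter.1 hb).2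
  have hfa : f a = b ∧ w a ≠ 0 := by simpa [basisMatrix] using ha
  exact ⟨a, by simpa using hfa.2, hfa.1⟩

end HammingNorm

/-! ### Thickened hypergraphs -/

section Thicken

theorem pathIncidence_transpose_mulVec {L : ℕ} (y : Fin L → ZMod 2) (k : Fin (L - 1)) :
    ((pathIncidence L)ᵀ *ᵥ y) k = y ⟨k, by omega⟩ + y ⟨k + 1, by omega⟩ := by
  rw [← Finset.sum_pair (a := (⟨k, by omega⟩ : Fin L)) (b := ⟨k + 1, by omega⟩) (f := y)
    (by simp [Fin.ext_iff])]
  simp only [Matrix.mulVec, dotProduct, Matrix.transpose_apply, pathIncidence, Matrix.of_apply,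
    ite_mul, one_mul, zero_mul, ← Finset.sum_filter]
  congr 1
  ext l
  simp [Fin.ext_iff]

variable {V E : Type*} [Fintype V] [DecidableEq V] {L : ℕ}

theorem thicken_transpose_mulVec_inl (G : Matrix V E (ZMod 2)) (w : V × Fin L → ZMod 2) (x : E)
    (l : Fin L) : ((thicken G L)ᵀ *ᵥ w) (Sum.inl (x, l)) = (Gᵀ *ᵥ fun v => w (v, l)) x := by
  simp [thicken, Matrix.mulVec, dotProduct, Fintype.sum_prod_type, Matrix.one_apply]

theorem thicken_transpose_mulVec_inr (G : Matrix V E (ZMod 2)) (w : V × Fin L → ZMod 2) (v : V)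
    (k : Fin (L - 1)) : ((thicken G L)ᵀ *ᵥ w) (Sum.inr (v, k))
      = w (v, ⟨k, by omega⟩) + w (v, ⟨k + 1, by omega⟩) := by
  rw [← pathIncidence_transpose_mulVec fun l => w (v, l)]
  simp only [thicken, Matrix.mulVec, dotProduct, Matrix.transpose_apply, Matrix.fromCols_apply_inr,
    Matrix.kroneckerMap_apply, Matrix.one_apply, ite_mul, one_mul, zero_mul, Fintype.sum_prod_type]
  rw [Fintype.sum_eq_single v fun v' hv => by simp [hv]]
  simp

theorem eq_of_thicken_transpose_mulVec_inr_eq_zero {G : Matrix V E (ZMod 2)}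
    {w : V × Fin L → ZMod 2} {v : V} (h : ∀ k, ((thicken G L)ᵀ *ᵥ w) (Sum.inr (v, k)) = 0)
    (l l' : Fin L) : w (v, l) = w (v, l') := by
  have hbottom (i : ℕ) (hi : i < L) : w (v, ⟨i, hi⟩) = w (v, ⟨0, by omega⟩) := by
    induction i with
    | zero => rfl
    | succ i ih =>
      have hrung := h ⟨i, by omega⟩
      rw [thicken_transpose_mulVec_inr, CharTwo.add_eq_zero] at hrung
      rw [← ih (by omega), ← hrung]
  rw [hbottom l l.2, hbottom l' l'.2]

theorem hammingNorm_level_add_level_le (G : Matrix V E (ZMod 2)) (w : V × Fin L → ZMod 2)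
    (l l' : Fin L) :
    hammingNorm (fun v => w (v, l) + w (v, l'))
      ≤ hammingNorm (((thicken G L)ᵀ *ᵥ w) ∘ Sum.inr) := by
  refine Finset.card_le_card_of_surjOn Prod.fst fun v hv => ?_
  by_contra hrungs
  refine (Finset.mem_filter.1 hv).2 (CharTwo.add_eq_zero.2 ?_)
  refine eq_of_thicken_transpose_mulVec_inr_eq_zero (G := G) (fun k => ?_) l l'
  by_contra hk
  exact hrungs ⟨(v, k), by simpa using hk, rfl⟩

variable [Fintype E]

-- The pigeonhole principle: the `L` levels have total syndrome weight at least `κ ∑ l, |y l|`.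
theorem IsClassicallySound.exists_level_hammingNorm_le {H : Matrix E V (ZMod 2)} {κ : ℝ}
    (hH : IsClassicallySound H κ) (hL : 1 ≤ κ * L) (w : V × Fin L → ZMod 2) :
    ∃ l y, (H *ᵥ y = H *ᵥ fun v => w (v, l)) ∧
      hammingNorm y ≤ hammingNorm (((thicken Hᵀ L)ᵀ *ᵥ w) ∘ Sum.inl) := by
  have hL0 : 0 < L := Nat.pos_of_ne_zero (by rintro rfl; norm_num at hL)
  choose y hy hyle using fun l => hH fun v => w (v, l)
  set s := hammingNorm (((thicken Hᵀ L)ᵀ *ᵥ w) ∘ Sum.inl) with hs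
  have hsum : ∑ l, (hammingNorm (H *ᵥ fun v => w (v, l)) : ℝ) = s := by
    rw [hs, hammingNorm_prodType]
    simp only [Function.comp_apply, thicken_transpose_mulVec_inl, Matrix.transpose_transpose]
    push_cast
    rfl
  have hκ : 0 < κ := pos_of_mul_pos_left (zero_lt_one.trans_le hL) L.cast_nonneg
  have htotal : ∑ l, κ * hammingNorm (y l) ≤ ∑ _l : Fin L, κ * s := calc
    ∑ l, κ * hammingNorm (y l) ≤ ∑ l, (hammingNorm (H *ᵥ fun v => w (v, l)) : ℝ) :=
      Finset.sum_le_sum fun l _ => hyle l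
    _ = s := hsum
    _ ≤ κ * L * s := le_mul_of_one_le_left s.cast_nonneg hL
    _ = ∑ _l : Fin L, κ * s := by
      rw [Finset.sum_const, Finset.card_univ, Fintype.card_fin, nsmul_eq_mul]
      ring
  obtain ⟨l, -, hl⟩ := Finset.exists_le_of_sum_le ⟨⟨0, hL0⟩, Finset.mem_univ _⟩ htotal
  exact ⟨l, y l, hy l, by exact_mod_cast le_of_mul_le_mul_left hl hκ⟩

-- Adding `y + w (·, k)` to every level changes neither the rungs nor, as `H y = H w (·, k)`, the
-- coboundary inside the levels; level `l` becomes `y + (w (·, l) + w (·, k))`.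
theorem IsClassicallySound.exists_thicken_transpose_mulVec_eq_and_level_le
    {H : Matrix E V (ZMod 2)} {κ : ℝ} (hH : IsClassicallySound H κ) (hL : 1 ≤ κ * L)
    (w : V × Fin L → ZMod 2) :
    ∃ w', (thicken Hᵀ L)ᵀ *ᵥ w' = (thicken Hᵀ L)ᵀ *ᵥ w ∧
      ∀ l, hammingNorm (fun v => w' (v, l)) ≤ hammingNorm ((thicken Hᵀ L)ᵀ *ᵥ w) := by
  obtain ⟨k, y, hy, hyle⟩ := hH.exists_level_hammingNorm_le hL w
  let shift : V → ZMod 2 := y + fun v => w (v, k)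
  have hshift : H *ᵥ shift = 0 := by
    rw [Matrix.mulVec_add, hy, ZModModule.add_self]
  refine ⟨fun p => shift p.1 + w p, ?_, fun l => ?_⟩
  · change (thicken Hᵀ L)ᵀ *ᵥ ((fun p => shift p.1) + w) = _
    rw [Matrix.mulVec_add, add_eq_right]
    ext (⟨x, l⟩ | ⟨v, i⟩)
    · rw [thicken_transpose_mulVec_inl, Matrix.transpose_transpose]
      exact congrFun hshift x
    · rw [thicken_transpose_mulVec_inr]
      exact CharTwo.add_self_eq_zero _
  · have hlevel : (fun v => shift v + w (v, l)) = y + fun v => w (v, k) + w (v, l) := by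
      ext v
      exact add_assoc _ _ _
    rw [hlevel, hammingNorm_sumType ((thicken Hᵀ L)ᵀ *ᵥ w)]
    exact (hammingNorm_add_le _ _).trans
      (add_le_add hyle (hammingNorm_level_add_level_le Hᵀ w k l))

end Thicken

/-! ### Nontrivial logical operators -/

/-- `v` satisfies the checks `M` and is not a product of the checks `M'`. The nontrivial logical `Z`
operators of a CSS code are the case `(M, M') = (HX, HZ)`, the nontrivial logical `X` operators the
case `(HZ, HX)`. -/
def IsNontrivialLogical {Q X Z R : Type*} [Fintype Q] [Fintype Z] [Semiring R] (M : Matrix X Q R)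
    (M' : Matrix Z Q R) (v : Q → R) : Prop :=
  M *ᵥ v = 0 ∧ ¬∃ w, M'ᵀ *ᵥ w = v

namespace CSSCode

variable {Q X Z : Type*} [Fintype Q] {C : CSSCode Q X Z} {d : ℕ}

theorem le_distZ_iff [Fintype Z] :
    (d : ℕ∞) ≤ C.distZ ↔ ∀ v, IsNontrivialLogical C.HX C.HZ v → d ≤ hammingNorm v := by
  simp only [distZ, le_iInf_iff, Nat.cast_le, IsNontrivialLogical, and_imp]

theorem le_distX_iff [Fintype X] :
    (d : ℕ∞) ≤ C.distX ↔ ∀ u, IsNontrivialLogical C.HZ C.HX u → d ≤ hammingNorm u := by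
  simp only [distX, le_iInf_iff, Nat.cast_le, IsNontrivialLogical, and_imp]

theorem le_distance_iff [Fintype X] [Fintype Z] :
    (d : ℕ∞) ≤ C.distance ↔ (d : ℕ∞) ≤ C.distX ∧ (d : ℕ∞) ≤ C.distZ :=
  le_min_iff

end CSSCode

section BlockDiagonal

variable {ι R : Type*} [Fintype ι] [DecidableEq ι] [Semiring R] {m m' n : ι → Type*}
  [∀ j, Fintype (n j)]

theorem blockDiagonal'_mulVec_apply (M : ∀ j, Matrix (m j) (n j) R) (u : (Σ j, n j) → R) (j : ι)
    (x : m j) :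
    (Matrix.blockDiagonal' M *ᵥ u) ⟨j, x⟩ = (M j *ᵥ fun q => u ⟨j, q⟩) x := by
  simp only [Matrix.mulVec, dotProduct, Fintype.sum_sigma]
  rw [Fintype.sum_eq_single j fun k hk => by simp [Matrix.blockDiagonal'_apply_ne _ _ _ hk.symm]]
  simp only [Matrix.blockDiagonal'_apply_eq]

theorem IsNontrivialLogical.exists_block [∀ j, Fintype (m' j)] {M : ∀ j, Matrix (m j) (n j) R}
    {M' : ∀ j, Matrix (m' j) (n j) R} {u : (Σ j, n j) → R}
    (hu : IsNontrivialLogical (Matrix.blockDiagonal' M) (Matrix.blockDiagonal' M') u) :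
    ∃ j, IsNontrivialLogical (M j) (M' j) fun q => u ⟨j, q⟩ := by
  by_contra! htrivial
  have hker (j : ι) : (M j *ᵥ fun q => u ⟨j, q⟩) = 0 := by
    ext x
    rw [← blockDiagonal'_mulVec_apply, hu.1]
    rfl
  choose y hy using fun j => not_not.1 fun h => htrivial j ⟨hker j, h⟩
  refine hu.2 ⟨fun p => y p.1 p.2, ?_⟩
  ext ⟨j, q⟩
  rw [Matrix.blockDiagonal'_transpose, blockDiagonal'_mulVec_apply]
  exact congrFun (hy j) q

end BlockDiagonal

/-! ### Distance of the deformed code -/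

theorem IsCycleBasis.exists_mulVec_eq {V E F : Type*} [Fintype E] [Fintype F]
    {G : Matrix V E (ZMod 2)} {N : Matrix E F (ZMod 2)} (hN : IsCycleBasis G N) {z : E → ZMod 2}
    (hz : G *ᵥ z = 0) : ∃ c, N *ᵥ c = z := by
  rw [← Matrix.mulVecLin_apply, ← LinearMap.mem_ker, ← hN.2] at hz
  exact hz

theorem IsCycleBasis.exists_transpose_mulVec_eq {V E F : Type*} [Fintype V] [Fintype E] [Fintype F]
    {G : Matrix V E (ZMod 2)} {N : Matrix E F (ZMod 2)} (hN : IsCycleBasis G N) {e : E → ZMod 2}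
    (he : Nᵀ *ᵥ e = 0) : ∃ w, Gᵀ *ᵥ w = e := by
  refine _root_.exists_transpose_mulVec_eq G e fun z hz => ?_
  obtain ⟨c, rfl⟩ := hN.exists_mulVec_eq hz
  rw [Matrix.dotProduct_mulVec, ← Matrix.mulVec_transpose, he, zero_dotProduct]

section Deformed

variable {QA XA ZA : Type*} [Fintype QA] [Fintype XA] {A : CSSCode QA XA ZA}
  {ι : Type*} {Q X Z : ι → Type*} [∀ j, Fintype (Q j)] [∀ j, Fintype (Z j)]
  [∀ j, DecidableEq (Q j)] [∀ j, DecidableEq (X j)] [∀ j, DecidableEq (Z j)]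
  {C : ∀ j, CSSCode (Q j) (X j) (Z j)} {L : ℕ}

theorem attachQubit_mulVec_apply (f : ∀ j, SubcodeMap A (C j)) (lev : ι → Fin L)
    (w : QA × Fin L → ZMod 2) (j : ι) (q : Q j) :
    (attachQubit f lev *ᵥ w) ⟨j, q⟩ = (basisMatrix (f j).qubit *ᵥ fun a => w (a, lev j)) q := by
  simp only [Matrix.mulVec, dotProduct, attachQubit, Matrix.of_apply, Fintype.sum_prod_type,
    ite_mul, zero_mul, Finset.sum_ite_eq', Finset.mem_univ, if_true]

variable [DecidableEq QA] [Fintype ι] [DecidableEq ι] {F : Type*} [Fintype F]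
  {N : Matrix (XA × Fin L ⊕ QA × Fin (L - 1)) F (ZMod 2)} (f : ∀ j, SubcodeMap A (C j))
  (lev : ι → Fin L) (hN : IsCycleBasis (thicken A.incidence L) N)

theorem deformedCode_HX_mulVec (u : (Σ j, Q j) → ZMod 2)
    (e : XA × Fin L ⊕ QA × Fin (L - 1) → ZMod 2) :
    (deformedCode f lev N hN).HX *ᵥ Sum.elim u e
      = Sum.elim (Matrix.blockDiagonal' (fun j => (C j).HX) *ᵥ u + attachXCheck f lev *ᵥ e)
        (Nᵀ *ᵥ e) := by
  simp [deformedCode, Matrix.fromBlocks_mulVec]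

theorem deformedCode_HZ_mulVec (u : (Σ j, Q j) → ZMod 2)
    (e : XA × Fin L ⊕ QA × Fin (L - 1) → ZMod 2) :
    (deformedCode f lev N hN).HZ *ᵥ Sum.elim u e
      = Sum.elim (Matrix.blockDiagonal' (fun j => (C j).HZ) *ᵥ u)
        ((attachQubit f lev)ᵀ *ᵥ u + thicken A.incidence L *ᵥ e) := by
  simp [deformedCode, Matrix.fromBlocks_mulVec]

theorem deformedCode_HZ_transpose_mulVec (y : (Σ j, Z j) → ZMod 2) (w : QA × Fin L → ZMod 2) :
    (deformedCode f lev N hN).HZᵀ *ᵥ Sum.elim y w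
      = Sum.elim ((Matrix.blockDiagonal' fun j => (C j).HZ)ᵀ *ᵥ y + attachQubit f lev *ᵥ w)
        ((thicken A.incidence L)ᵀ *ᵥ w) := by
  simp [deformedCode, Matrix.fromBlocks_transpose, Matrix.fromBlocks_mulVec]

variable {f lev hN}

-- Cleaning: multiplying by the `Z`-checks of the vertices in `w` removes `e`.
theorem IsNontrivialLogical.exists_block_Z {u : (Σ j, Q j) → ZMod 2} {w : QA × Fin L → ZMod 2}
    (h : IsNontrivialLogical (deformedCode f lev N hN).HX (deformedCode f lev N hN).HZ
      (Sum.elim u ((thicken A.incidence L)ᵀ *ᵥ w))) :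
    ∃ j, IsNontrivialLogical (C j).HX (C j).HZ
      ((fun q => u ⟨j, q⟩) + basisMatrix (f j).qubit *ᵥ fun a => w (a, lev j)) := by
  have hblocks : IsNontrivialLogical (Matrix.blockDiagonal' fun j => (C j).HX)
      (Matrix.blockDiagonal' fun j => (C j).HZ) (u + attachQubit f lev *ᵥ w) := by
    refine ⟨?_, ?_⟩
    · have hker := h.1
      rw [deformedCode_HX_mulVec] at hker
      rw [Matrix.mulVec_add, Matrix.mulVec_mulVec, attach_comm, ← Matrix.mulVec_mulVec]
      exact congrArg (· ∘ Sum.inl) hker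
    · rintro ⟨y, hy⟩
      refine h.2 ⟨Sum.elim y w, ?_⟩
      rw [deformedCode_HZ_transpose_mulVec, hy, add_assoc, ZModModule.add_self, add_zero]
  obtain ⟨j, hj⟩ := hblocks.exists_block
  refine ⟨j, ?_⟩
  convert hj using 1
  ext q
  rw [Pi.add_apply, Pi.add_apply, attachQubit_mulVec_apply]

theorem le_distZ_deformedCode {κ : ℝ} (hA : IsClassicallySound A.HX κ) (hL : 1 ≤ κ * L) {d : ℕ}
    (hd : ∀ j, (d : ℕ∞) ≤ (C j).distZ) : (d : ℕ∞) ≤ (deformedCode f lev N hN).distZ := by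
  refine CSSCode.le_distZ_iff.2 fun v hv => ?_
  obtain ⟨u, e, rfl⟩ : ∃ u e, v = Sum.elim u e := ⟨_, _, (Sum.elim_comp_inl_inr v).symm⟩
  have he : Nᵀ *ᵥ e = 0 := by
    have hker := hv.1
    rw [deformedCode_HX_mulVec] at hker
    exact congrArg (· ∘ Sum.inr) hker
  obtain ⟨w₀, rfl⟩ := hN.exists_transpose_mulVec_eq he
  obtain ⟨w, hw, hwle⟩ := hA.exists_thicken_transpose_mulVec_eq_and_level_le hL w₀
  rw [CSSCode.incidence, ← hw] at hv
  obtain ⟨j, hj⟩ := hv.exists_block_Z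
  calc d ≤ hammingNorm ((fun q => u ⟨j, q⟩) + basisMatrix (f j).qubit *ᵥ fun a => w (a, lev j)) :=
        CSSCode.le_distZ_iff.1 (hd j) _ hj
    _ ≤ hammingNorm (fun q => u ⟨j, q⟩)
        + hammingNorm (basisMatrix (f j).qubit *ᵥ fun a => w (a, lev j)) := hammingNorm_add_le _ _
    _ ≤ hammingNorm u + hammingNorm ((thicken A.incidence L)ᵀ *ᵥ w₀) :=
      add_le_add (hammingNorm_comp_le_of_injective sigma_mk_injective u)
        ((hammingNorm_basisMatrix_mulVec_le _ _).trans (hwle _))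
    _ = hammingNorm (Sum.elim u ((thicken A.incidence L)ᵀ *ᵥ w₀)) :=
      (hammingNorm_sumType (Sum.elim u _)).symm

variable [∀ j, Fintype (X j)]

variable (f lev hN) in
theorem deformedCode_HX_transpose_mulVec (x : (Σ j, X j) → ZMod 2) (c : F → ZMod 2) :
    (deformedCode f lev N hN).HXᵀ *ᵥ Sum.elim x c
      = Sum.elim ((Matrix.blockDiagonal' fun j => (C j).HX)ᵀ *ᵥ x)
        ((attachXCheck f lev)ᵀ *ᵥ x + N *ᵥ c) := by
  simp [deformedCode, Matrix.fromBlocks_transpose, Matrix.fromBlocks_mulVec]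

-- If `u` is the product of the `X`-checks `x` of the blocks, then `e` differs from the restriction
-- of these checks to the new qubits by a cycle, which is a product of cycle checks.
theorem IsNontrivialLogical.exists_block_X {u : (Σ j, Q j) → ZMod 2}
    {e : XA × Fin L ⊕ QA × Fin (L - 1) → ZMod 2}
    (h : IsNontrivialLogical (deformedCode f lev N hN).HZ (deformedCode f lev N hN).HX
      (Sum.elim u e)) :
    ∃ j, IsNontrivialLogical (C j).HZ (C j).HX fun q => u ⟨j, q⟩ := by
  have hker := h.1
  rw [deformedCode_HZ_mulVec] at hker
  refine IsNontrivialLogical.exists_block ⟨congrArg (· ∘ Sum.inl) hker, ?_⟩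
  rintro ⟨x, hx⟩
  have hcycle : thicken A.incidence L *ᵥ ((attachXCheck f lev)ᵀ *ᵥ x + e) = 0 := by
    have hcomm := congrArg Matrix.transpose (attach_comm f lev)
    rw [Matrix.transpose_mul, Matrix.transpose_mul, Matrix.transpose_transpose] at hcomm
    rw [Matrix.mulVec_add, Matrix.mulVec_mulVec, ← hcomm, ← Matrix.mulVec_mulVec, hx]
    exact congrArg (· ∘ Sum.inr) hker
  obtain ⟨c, hc⟩ := hN.exists_mulVec_eq hcycle
  refine h.2 ⟨Sum.elim x c, ?_⟩
  rw [deformedCode_HX_transpose_mulVec, hx, hc, ← add_assoc, ZModModule.add_self, zero_add]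

theorem le_distX_deformedCode {d : ℕ} (hd : ∀ j, (d : ℕ∞) ≤ (C j).distX) :
    (d : ℕ∞) ≤ (deformedCode f lev N hN).distX := by
  refine CSSCode.le_distX_iff.2 fun v hv => ?_
  obtain ⟨u, e, rfl⟩ : ∃ u e, v = Sum.elim u e := ⟨_, _, (Sum.elim_comp_inl_inr v).symm⟩
  obtain ⟨j, hj⟩ := hv.exists_block_X
  exact (CSSCode.le_distX_iff.1 (hd j) _ hj).trans
    (hammingNorm_comp_le_of_injective (Sum.inl_injective.comp sigma_mk_injective) (Sum.elim u e))

theorem le_distance_deformedCode {κ : ℝ} (hA : IsClassicallySound A.HX κ) (hL : 1 ≤ κ * L) {d : ℕ}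
    (hd : ∀ j, (d : ℕ∞) ≤ (C j).distance) :
    (d : ℕ∞) ≤ (deformedCode f lev N hN).distance :=
  CSSCode.le_distance_iff.2
    ⟨le_distX_deformedCode fun j => (CSSCode.le_distance_iff.1 (hd j)).1,
      le_distZ_deformedCode hA hL fun j => (CSSCode.le_distance_iff.1 (hd j)).2⟩

end Deformed

/-! ### Space cost -/

namespace CSSCode

variable {Q X Z : Type*} [Fintype Q] [Fintype X] [Fintype Z] {C : CSSCode Q X Z} {σ : ℕ}

theorem everyQubitChecked_of_two_le_distance (h : 2 ≤ C.distance) : C.EveryQubitChecked := by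
  classical
  intro q
  by_contra! hq
  have hlogical : IsNontrivialLogical C.HX C.HZ (Pi.single q 1) := by
    refine ⟨by ext i; simpa using hq.1 i, ?_⟩
    rintro ⟨w, hw⟩
    have hwq : (C.HZᵀ *ᵥ w) q = 0 :=
      Finset.sum_eq_zero fun i _ => mul_eq_zero_of_left (hq.2 i) (w i)
    rw [hw, Pi.single_eq_same] at hwq
    exact one_ne_zero hwq
  have htwo : 2 ≤ hammingNorm (Pi.single q 1 : Q → ZMod 2) :=
    le_distZ_iff.1 (le_distance_iff.1 h).2 _ hlogical
  have hone : hammingNorm (Pi.single q 1 : Q → ZMod 2) ≤ 1 := by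
    refine (Finset.card_le_card (t := {q}) fun p hp => ?_).trans_eq (Finset.card_singleton q)
    by_contra hne
    exact (Finset.mem_filter.1 hp).2 (Pi.single_eq_of_ne (by simpa using hne) 1)
  omega

theorem IsSparse.card_qubits_le (h : C.IsSparse σ) (hC : C.EveryQubitChecked) :
    Fintype.card Q ≤ (Fintype.card X + Fintype.card Z) * σ := by
  classical
  have hcover : (Finset.univ : Finset Q) ⊆ (Finset.univ : Finset (X ⊕ Z)).biUnion fun i =>
      Finset.univ.filter fun q => Sum.elim C.HX C.HZ i q ≠ 0 := by
    intro q _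
    simp only [Finset.mem_biUnion, Finset.mem_filter, Finset.mem_univ, true_and]
    rcases hC q with ⟨i, hi⟩ | ⟨i, hi⟩
    · exact ⟨Sum.inl i, hi⟩
    · exact ⟨Sum.inr i, hi⟩
  rw [← Fintype.card_sum]
  refine (Finset.card_le_card hcover).trans (Finset.card_biUnion_le_card_mul _ _ _ fun i _ => ?_)
  rcases i with i | i
  · exact h.1 i
  · exact h.2.2.1 i

end CSSCode

theorem IsClassicallySound.le_hammingNorm_column {I V R : Type*} [Fintype I] [Fintype V]
    [Semiring R] [DecidableEq R] {H : Matrix I V R} {κ : ℝ} (hH : IsClassicallySound H κ)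
    (hκ : 0 ≤ κ) {i : I} {q : V} (hiq : H i q ≠ 0) : κ ≤ hammingNorm (Hᵀ q) := by
  classical
  have hcolumn : H *ᵥ Pi.single q 1 = Hᵀ q := Matrix.mulVec_single_one H q
  obtain ⟨w, hw, hle⟩ := hH (Pi.single q 1)
  rw [hcolumn] at hw hle
  have hw0 : w ≠ 0 := by
    rintro rfl
    rw [Matrix.mulVec_zero] at hw
    exact hiq (congrFun hw i).symm
  have hpos : (1 : ℝ) ≤ hammingNorm w := by exact_mod_cast hammingNorm_pos_iff.2 hw0
  exact (le_mul_of_one_le_right hκ hpos).trans hle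

theorem IsCycleBasis.card_le {V E F : Type*} [Fintype E] [Fintype F] {G : Matrix V E (ZMod 2)}
    {N : Matrix E F (ZMod 2)} (hN : IsCycleBasis G N) : Fintype.card F ≤ Fintype.card E := by
  simpa only [Module.finrank_fintype_fun_eq_card] using
    LinearMap.finrank_le_finrank_of_injective (f := N.mulVecLin) hN.1

namespace CSSCode

variable {Q X Z : Type*} [Fintype Q] [DecidableEq Q] [Fintype X] [Fintype Z] {C : CSSCode Q X Z}
  {σ : ℕ}

theorem IsSparse.card_checks_le {ρ : ℝ} (h : C.IsSparse σ) (hC : C.EveryQubitChecked)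
    (hS : HasQuantumSoundness C.generators ρ) (hρ : 0 < ρ) (hQ : 0 < Fintype.card Q) :
    ((Fintype.card X + Fintype.card Z : ℕ) : ℝ) ≤ σ * (Fintype.card Q / ρ) := by
  have hsound : ρ * (Fintype.card X + Fintype.card Z : ℕ) / Fintype.card Q ≤ σ := by
    obtain ⟨q⟩ : Nonempty Q := Fintype.card_pos_iff.1 hQ
    rcases hC q with ⟨i, hi⟩ | ⟨i, hi⟩
    · exact ((isClassicallySound_HX hS hρ.le).le_hammingNorm_column (by positivity) hi).trans
        (by exact_mod_cast h.2.1 q)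
    · exact ((isClassicallySound_HZ hS hρ.le).le_hammingNorm_column (by positivity) hi).trans
        (by exact_mod_cast h.2.2.2 q)
  rw [div_le_iff₀ (by exact_mod_cast hQ)] at hsound
  rwa [← mul_div_assoc, le_div_iff₀' hρ]

theorem IsSparse.card_new_le (h : C.IsSparse σ) (hC : C.EveryQubitChecked) {L : ℕ} {F : Type*}
    [Fintype F] {N : Matrix (X × Fin L ⊕ Q × Fin (L - 1)) F (ZMod 2)}
    (hN : IsCycleBasis (thicken C.incidence L) N) :
    Fintype.card (X × Fin L ⊕ Q × Fin (L - 1)) + Fintype.card (Q × Fin L) + Fintype.card F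
      ≤ (2 + 3 * σ) * ((Fintype.card X + Fintype.card Z) * L) := by
  have hcycles := hN.card_le
  simp only [Fintype.card_sum, Fintype.card_prod, Fintype.card_fin] at hcycles ⊢
  have hrungs : Fintype.card Q * (L - 1) ≤ Fintype.card Q * L :=
    Nat.mul_le_mul_left _ (Nat.sub_le L 1)
  have hvertices : Fintype.card Q * L ≤ (Fintype.card X + Fintype.card Z) * σ * L :=
    Nat.mul_le_mul_right L (h.card_qubits_le hC)
  linarith [Nat.zero_le (Fintype.card Z * L)]

theorem IsSparse.card_new_le_of_hasQuantumSoundness {τ ρ : ℝ} (h : C.IsSparse σ)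
    (hC : C.EveryQubitChecked) (hS : HasQuantumSoundness C.generators ρ) (hρ : 0 < ρ)
    (hQ : 0 < Fintype.card Q) (hτ : 0 ≤ τ) (hm : 0 < Fintype.card X + Fintype.card Z) {L : ℕ}
    (hL : L = ⌈τ * (Fintype.card Q : ℝ) / (ρ * (Fintype.card X + Fintype.card Z : ℕ))⌉₊)
    {F : Type*} [Fintype F] {N : Matrix (X × Fin L ⊕ Q × Fin (L - 1)) F (ZMod 2)}
    (hN : IsCycleBasis (thicken C.incidence L) N) :
    ((Fintype.card (X × Fin L ⊕ Q × Fin (L - 1)) + Fintype.card (Q × Fin L)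
      + Fintype.card F : ℕ) : ℝ) ≤ (2 + 3 * σ) * (τ + σ) * (Fintype.card Q / ρ) := by
  set m : ℕ := Fintype.card X + Fintype.card Z
  set n : ℕ := Fintype.card Q
  have hm' : (0 : ℝ) < m := by exact_mod_cast hm
  have hLle : (L : ℝ) ≤ τ * n / (ρ * m) + 1 := by
    rw [hL]
    exact (Nat.ceil_lt_add_one (by positivity)).le
  have hmL : m * (L : ℝ) ≤ (τ + σ) * (n / ρ) := calc
    m * (L : ℝ) ≤ m * (τ * n / (ρ * m) + 1) := mul_le_mul_of_nonneg_left hLle hm'.le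
    _ = τ * (n / ρ) + m := by field_simp
    _ ≤ τ * (n / ρ) + σ * (n / ρ) := add_le_add_right (h.card_checks_le hC hS hρ hQ) _
    _ = (τ + σ) * (n / ρ) := (add_mul _ _ _).symm
  calc _ ≤ (((2 + 3 * σ) * (m * L) : ℕ) : ℝ) := Nat.cast_le.2 (h.card_new_le hC hN)
    _ = (2 + 3 * σ) * (m * L) := by push_cast; ring
    _ ≤ (2 + 3 * σ) * ((τ + σ) * (n / ρ)) := mul_le_mul_of_nonneg_left hmL (by positivity)
    _ = (2 + 3 * σ) * (τ + σ) * (n / ρ) := (mul_assoc _ _ _).symm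

end CSSCode

theorem mainTheorem12_general (σ : ℕ) {τ : ℝ} (hτ : 1 ≤ τ) :
    ∃ c : ℝ, 0 < c ∧
      ∀ (QA XA ZA : Type*) [Fintype QA] [Fintype XA] [Fintype ZA]
        [DecidableEq QA]
        (A : CSSCode QA XA ZA) (ρ : ℝ),
        0 < ρ → HasQuantumSoundness A.generators ρ →
        0 < Fintype.card QA → 0 < Fintype.card XA + Fintype.card ZA →
        (∀ (ι : Type*) [Fintype ι] [DecidableEq ι] (Q X Z : ι → Type*)
          [∀ j, Fintype (Q j)] [∀ j, Fintype (X j)] [∀ j, Fintype (Z j)]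
          [∀ j, DecidableEq (Q j)] [∀ j, DecidableEq (X j)] [∀ j, DecidableEq (Z j)]
          (C : ∀ j, CSSCode (Q j) (X j) (Z j)) (f : ∀ j, SubcodeMap A (C j))
          (d L : ℕ) (lev : ι → Fin L) (F : Type*) [Fintype F]
          (N : Matrix (XA × Fin L ⊕ QA × Fin (L - 1)) F (ZMod 2))
          (hN : IsCycleBasis (thicken A.incidence L) N),
          τ * (Fintype.card QA : ℝ) / (ρ * ((Fintype.card XA + Fintype.card ZA : ℕ) : ℝ)) ≤ L →
          (∀ j, (d : ℕ∞) ≤ (C j).distance) →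
          (d : ℕ∞) ≤ (deformedCode f lev N hN).distance) ∧
        (A.IsSparse σ → (2 ≤ A.distance ∨ A.EveryQubitChecked) →
          ∀ (L : ℕ),
          L = ⌈τ * (Fintype.card QA : ℝ) /
            (ρ * ((Fintype.card XA + Fintype.card ZA : ℕ) : ℝ))⌉₊ →
          ∀ (F : Type*) [Fintype F]
          (N : Matrix (XA × Fin L ⊕ QA × Fin (L - 1)) F (ZMod 2)),
          IsCycleBasis (thicken A.incidence L) N →
          ((Fintype.card (XA × Fin L ⊕ QA × Fin (L - 1)) + Fintype.card (QA × Fin L)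
              + Fintype.card F : ℕ) : ℝ)
            ≤ c * (Fintype.card QA / ρ)) := by
  refine ⟨(2 + 3 * σ) * (τ + σ), by positivity, ?_⟩
  intro QA XA ZA _ _ _ _ A ρ hρ hS hn hm
  refine ⟨?_, ?_⟩
  · intro ι _ _ Q X Z _ _ _ _ _ _ C f d L lev F _ N hN hL hd
    refine le_distance_deformedCode (A.isClassicallySound_HX hS hρ.le) ?_ hd
    have hn' : (0 : ℝ) < Fintype.card QA := by exact_mod_cast hn
    have hm' : (0 : ℝ) < (Fintype.card XA + Fintype.card ZA : ℕ) := by exact_mod_cast hm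
    rw [div_le_iff₀ (mul_pos hρ hm')] at hL
    rw [div_mul_eq_mul_div, one_le_div hn', mul_comm]
    exact (le_mul_of_one_le_left hn'.le hτ).trans hL
  · intro hsparse hchecked L hL F _ N hN
    have hC := hchecked.elim CSSCode.everyQubitChecked_of_two_le_distance id
    exact hsparse.card_new_le_of_hasQuantumSoundness hC hS hρ hn (zero_le_one.trans hτ) hm hL hN

theorem mainTheorem12 (σ : ℕ) :
    ∃ c : ℝ, 0 < c ∧
      ∀ (QA XA ZA : Type*) [Fintype QA] [Fintype XA] [Fintype ZA]
        [DecidableEq QA]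
        (A : CSSCode QA XA ZA) (ω : ℕ) (ρ : ℝ),
        0 < ρ → A.IsLocallyTestable ω ρ →
        0 < Fintype.card QA → 0 < Fintype.card XA + Fintype.card ZA →
        -- the distance is preserved
        (∀ (ι : Type*) [Fintype ι] [DecidableEq ι] (Q X Z : ι → Type*)
          [∀ j, Fintype (Q j)] [∀ j, Fintype (X j)] [∀ j, Fintype (Z j)]
          [∀ j, DecidableEq (Q j)] [∀ j, DecidableEq (X j)] [∀ j, DecidableEq (Z j)]
          (C : ∀ j, CSSCode (Q j) (X j) (Z j)) (f : ∀ j, SubcodeMap A (C j))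
          (d L : ℕ) (lev : ι → Fin L) (F : Type*) [Fintype F]
          (N : Matrix (XA × Fin L ⊕ QA × Fin (L - 1)) F (ZMod 2))
          (hN : IsCycleBasis (thicken A.incidence L) N),
          2 * (Fintype.card QA : ℝ) / (ρ * ((Fintype.card XA + Fintype.card ZA : ℕ) : ℝ)) ≤ L →
          (∀ j, (d : ℕ∞) ≤ (C j).distance) →
          (d : ℕ∞) ≤ (deformedCode f lev N hN).distance) ∧
        -- the space cost: new data qubits, vertex checks and cycle checks
        (A.IsSparse σ → (2 ≤ A.distance ∨ A.EveryQubitChecked) →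
          ∀ (L : ℕ),
          L = ⌈2 * (Fintype.card QA : ℝ) /
            (ρ * ((Fintype.card XA + Fintype.card ZA : ℕ) : ℝ))⌉₊ →
          ∀ (F : Type*) [Fintype F]
          (N : Matrix (XA × Fin L ⊕ QA × Fin (L - 1)) F (ZMod 2)),
          IsCycleBasis (thicken A.incidence L) N →
          ((Fintype.card (XA × Fin L ⊕ QA × Fin (L - 1)) + Fintype.card (QA × Fin L)
              + Fintype.card F : ℕ) : ℝ)
            ≤ c * (Fintype.card QA / ρ)) := by
  obtain ⟨c, hc, h⟩ := mainTheorem12_general σ one_le_two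
  exact ⟨c, hc, fun QA XA ZA _ _ _ _ A ω ρ hρ hA => h QA XA ZA A ρ hρ hA.2.2⟩
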